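/- Let $\phi\in\Psi_n$ be a characteristic generator, i.e. $\phi:[0,\infty)\to\mathbb R$ and $\mathbf t\mapsto\phi(\mathbf t'\mathbf t)$ is the characteristic function of a probability distribution on $\mathbb R^n$ (so $\phi(0)=1$), and assume that $\phi$ is not identically $1$. Write $\mathbf X\sim E_n(\boldsymbol\mu,\boldsymbol\Sigma,\phi)$, with $\boldsymbol\mu\in\mathbb R^n$ and $\boldsymbol\Sigma$ a symmetric positive semidefinite $n\times n$ matrix, if the random vector $\mathbf X$ has characteristic function $\mathbf t\mapsto e^{i\mathbf t'\boldsymbol\mu}\phi(\mathbf t'\boldsymbol\Sigma\mathbf t)$. Let $\mathbf X\sim E_n(\boldsymbol\mu^x,\boldsymbol\Sigma^x,\phi)$ and $\mathbf Y\sim E_n(\boldsymbol\mu^y,\boldsymbol\Sigma^y,\phi)$ be random vectors in $\mathbb R^n$ with finite expectations, $E\|\mathbf X\|<\infty$ and $E\|\mathbf Y\|<\infty$. Then the following statements are equivalent: (1) $\boldsymbol\mu^y=\boldsymbol\mu^x$ and $\boldsymbol\Sigma^y-\boldsymbol\Sigma^x$ is positive semidefinite; (2) $\mathbf X\le_{cx}\mathbf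 Y$, i.e. $E[f(\mathbf X)]\le E[f(\mathbf Y)]$ for every convex $f:\mathbb R^n\to\mathbb R$ for which both $f(\mathbf X)$ and $f(\mathbf Y)$ are integrable; (3) $\mathbf X\le_{lcx}\mathbf Y$ (linear convex order), i.e. $E[f(\mathbf a'\mathbf X)]\le E[f(\mathbf a'\mathbf Y)]$ for every $\mathbf a\in\mathbb R^n$ and every convex $f:\mathbb R\to\mathbb R$ for which both $f(\mathbf a'\mathbf X)$ and $f(\mathbf a'\mathbf Y)$ are integrable. -/

import Mathlib

open MeasureTheory
open scoped Matrix

/-- The class `Ψₙ` of characteristic generators: `φ ∈ Ψₙ` iff `t ↦ φ(t't)` is the characteristic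
function of a probability law on `ℝⁿ`. In particular `φ 0 = 1`. Only the values of `φ` on `[0, ∞)`
matter. -/
def IsCharGenerator (n : ℕ) (φ : ℝ → ℝ) : Prop :=
  ∃ ν : Measure (EuclideanSpace ℝ (Fin n)), IsProbabilityMeasure ν ∧
    ∀ t : EuclideanSpace ℝ (Fin n), charFun ν t = ((φ (‖t‖ ^ 2) : ℝ) : ℂ)

/-- `X ∼ Eₙ(m, S, φ)`: the random vector `X` (on the probability space `(Ω, P)`) is elliptically
distributed with location vector `m`, positive semidefinite dispersion matrix `S` and
characteristic generator `φ`, i.e. its characteristic function is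
`t ↦ exp(i t'm) φ(t'St)`. -/
structure IsElliptical {Ω : Type*} [MeasurableSpace Ω] {n : ℕ} (P : Measure Ω)
    (X : Ω → EuclideanSpace ℝ (Fin n)) (m : EuclideanSpace ℝ (Fin n))
    (S : Matrix (Fin n) (Fin n) ℝ) (φ : ℝ → ℝ) : Prop where
  measurable : Measurable X
  generator : IsCharGenerator n φ
  posSemidef : S.PosSemidef
  charFun_eq : ∀ t : EuclideanSpace ℝ (Fin n),
    charFun (P.map X) t =
      Complex.exp (Complex.I * ((inner ℝ t m : ℝ) : ℂ)) * ((φ (t.ofLp ⬝ᵥ (S *ᵥ t.ofLp)) : ℝ) : ℂ)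

/-- Convex order `X ≤_cx Y`: `E f(X) ≤ E f(Y)` for all convex `f : ℝⁿ → ℝ` for which both
expectations exist. -/
def ConvexOrder {Ω Ω' : Type*} [MeasurableSpace Ω] [MeasurableSpace Ω'] {n : ℕ}
    (P : Measure Ω) (Q : Measure Ω')
    (X : Ω → EuclideanSpace ℝ (Fin n)) (Y : Ω' → EuclideanSpace ℝ (Fin n)) : Prop :=
  ∀ f : EuclideanSpace ℝ (Fin n) → ℝ, ConvexOn ℝ Set.univ f →
    Integrable (fun ω => f (X ω)) P → Integrable (fun ω => f (Y ω)) Q →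
      ∫ ω, f (X ω) ∂P ≤ ∫ ω, f (Y ω) ∂Q

/-- Linear convex order `X ≤_lcx Y`: `E f(a'X) ≤ E f(a'Y)` for all `a ∈ ℝⁿ` and all convex
`f : ℝ → ℝ` for which both expectations exist. -/
def LinearConvexOrder {Ω Ω' : Type*} [MeasurableSpace Ω] [MeasurableSpace Ω'] {n : ℕ}
    (P : Measure Ω) (Q : Measure Ω')
    (X : Ω → EuclideanSpace ℝ (Fin n)) (Y : Ω' → EuclideanSpace ℝ (Fin n)) : Prop :=
  ∀ (a : EuclideanSpace ℝ (Fin n)) (f : ℝ → ℝ), ConvexOn ℝ Set.univ f →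
    Integrable (fun ω => f (inner ℝ a (X ω))) P → Integrable (fun ω => f (inner ℝ a (Y ω))) Q →
      ∫ ω, f (inner ℝ a (X ω)) ∂P ≤ ∫ ω, f (inner ℝ a (Y ω)) ∂Q

/-!
If `Sx ≤ Sy = B Bᵀ`, Douglas' factorization gives `Sx = (B K) (B K)ᵀ` with a symmetric contraction
`K`, and `K` is a convex combination of orthogonal matrices `U` by the spectral theorem. For a
spherical `V` with generator `φ`, the vector `m + B K V` has the law of `X` and every `m + B U V`
has the law of `Y`, so that `X ≤_cx Y` is Jensen's inequality.

Conversely, each `a'(X - m)` has characteristic function `s ↦ φ(s² a'Sx a)`, so it is symmetric,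
whence `m = E X`, and up to a scale factor `√(a'Sx a)` its law is the same for `X` and `Y`.
Applying the linear convex order to `± x` compares the means, and applying it to `|x - a'm|`
compares the scale factors, since `φ ≢ 1` makes `E|a'(X - m)|` positive when `a'Sx a` is.
-/

open ProbabilityTheory Matrix
open scoped RealInnerProductSpace

section Contraction

open scoped MatrixOrder Matrix.Norms.L2Operator ComplexOrder

variable {𝕜 : Type*} [RCLike 𝕜]

lemma exists_norm_le_one_comp_eq {E F G : Type*} [AddCommGroup E] [Module 𝕜 E]
    [NormedAddCommGroup F] [InnerProductSpace 𝕜 F] [NormedAddCommGroup G] [NormedSpace 𝕜 G]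
    (T : E →ₗ[𝕜] F) [T.range.HasOrthogonalProjection] (S : E →ₗ[𝕜] G)
    (h : ∀ x, ‖S x‖ ≤ ‖T x‖) :
    ∃ D : F →L[𝕜] G, ‖D‖ ≤ 1 ∧ D ∘ₗ T = S := by
  have hbdd : ∃ C : ℝ, ∀ x, ‖S x‖ ≤ C * ‖T x‖ := ⟨1, by simpa using h⟩
  have hD₀ (x : E) : S.compLeftInverse T ⟨T x, x, rfl⟩ = S x :=
    S.compLeftInverse_apply_of_bdd T hbdd x (T x) rfl
  have hD₀_norm : ‖S.compLeftInverse T‖ ≤ 1 := by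
    refine ContinuousLinearMap.opNorm_le_bound _ zero_le_one ?_
    rintro ⟨_, x, rfl⟩
    simpa [hD₀] using h x
  refine ⟨(S.compLeftInverse T).comp T.range.orthogonalProjectionOnto, ?_, ?_⟩
  · exact (ContinuousLinearMap.opNorm_comp_le _ _).trans
      (mul_le_one₀ hD₀_norm (norm_nonneg _) T.range.orthogonalProjectionOnto_norm_le)
  · ext x
    simpa [T.range.orthogonalProjectionOnto_mem_subspace_eq_self ⟨T x, x, rfl⟩] using hD₀ x

variable {n : Type*} [Fintype n]

lemma exists_mul_conjTranspose_eq {S : Matrix n n 𝕜} (hS : S.PosSemidef) :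
    ∃ A : Matrix n n 𝕜, A * Aᴴ = S := by
  classical
  obtain ⟨A, hA⟩ := CStarAlgebra.nonneg_iff_eq_mul_star_self.mp hS.nonneg
  exact ⟨A, hA.symm⟩

variable [DecidableEq n]

lemma ofReal_norm_toEuclideanCLM_conjTranspose_sq (A : Matrix n n 𝕜) (x : EuclideanSpace 𝕜 n) :
    ((‖toEuclideanCLM (𝕜 := 𝕜) Aᴴ x‖ ^ 2 : ℝ) : 𝕜) = star x.ofLp ⬝ᵥ ((A * Aᴴ) *ᵥ x.ofLp) := by
  rw [← mulVec_mulVec, dotProduct_mulVec, RCLike.ofReal_pow, ← inner_self_eq_norm_sq_to_K,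
    EuclideanSpace.inner_eq_star_dotProduct, ofLp_toEuclideanCLM, star_mulVec,
    conjTranspose_conjTranspose, dotProduct_comm]

lemma exists_norm_le_one_mul_eq {A B : Matrix n n 𝕜} (h : A * Aᴴ ≤ B * Bᴴ) :
    ∃ C : Matrix n n 𝕜, ‖C‖ ≤ 1 ∧ B * C = A := by
  have hnorm (x : EuclideanSpace 𝕜 n) :
      ‖toEuclideanCLM (𝕜 := 𝕜) Aᴴ x‖ ≤ ‖toEuclideanCLM (𝕜 := 𝕜) Bᴴ x‖ := by
    have hx := (le_iff.mp h).dotProduct_mulVec_nonneg x.ofLp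
    rw [sub_mulVec, dotProduct_sub, ← ofReal_norm_toEuclideanCLM_conjTranspose_sq,
      ← ofReal_norm_toEuclideanCLM_conjTranspose_sq, sub_nonneg, RCLike.ofReal_le_ofReal] at hx
    exact le_of_sq_le_sq hx (norm_nonneg _)
  obtain ⟨D, hD, hDB⟩ := exists_norm_le_one_comp_eq
    (toEuclideanCLM (𝕜 := 𝕜) Bᴴ).toLinearMap (toEuclideanCLM (𝕜 := 𝕜) Aᴴ).toLinearMap hnorm
  obtain ⟨D, rfl⟩ := (toEuclideanCLM (n := n) (𝕜 := 𝕜)).surjective D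
  have hDB' : D * Bᴴ = Aᴴ := by
    apply (toEuclideanCLM (n := n) (𝕜 := 𝕜)).injective
    ext1 x
    simpa only [map_mul] using! LinearMap.congr_fun hDB x
  exact ⟨Dᴴ, by rwa [l2_opNorm_conjTranspose], by simpa using congrArg conjTranspose hDB'⟩

lemma diagonal_ofReal_mem_convexHull_unitaryGroup {d : n → ℝ} (hd : ∀ i, |d i| ≤ 1) :
    diagonal (fun i => (d i : 𝕜)) ∈ convexHull ℝ (unitaryGroup n 𝕜 : Set (Matrix n n 𝕜)) := by
  have hcube : d ∈ convexHull ℝ (Set.univ.pi fun _ => {-1, 1}) := by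
    refine mem_convexHull_pi fun i _ => ?_
    rw [convexHull_pair, segment_eq_Icc (by norm_num), Set.mem_Icc, ← abs_le]
    exact hd i
  let diagonalOfReal : (n → ℝ) →ₗ[ℝ] Matrix n n 𝕜 :=
    diagonalLinearMap n ℝ 𝕜 ∘ₗ (Algebra.linearMap ℝ 𝕜).compLeft n
  have hsigns : diagonalOfReal '' Set.univ.pi (fun _ => {-1, 1}) ⊆ unitaryGroup n 𝕜 := by
    rintro _ ⟨z, hz, rfl⟩
    have hz_sq (i : n) : (z i : 𝕜) * z i = 1 := by
      have hzi : z i = -1 ∨ z i = 1 := hz i trivial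
      rcases hzi with hzi | hzi <;> simp [hzi]
    have hdiag : diagonalOfReal z = diagonal (fun i => (z i : 𝕜)) := rfl
    simp [hdiag, mem_unitaryGroup_iff, star_eq_conjTranspose, Pi.star_def, hz_sq]
  have himage := Set.mem_image_of_mem diagonalOfReal hcube
  rw [diagonalOfReal.image_convexHull] at himage
  exact convexHull_mono hsigns himage

lemma abs_eigenvalues_le_norm {A : Matrix n n 𝕜} (hA : A.IsHermitian) (i : n) :
    |hA.eigenvalues i| ≤ ‖A‖ := by
  simpa [hA.mulVec_eigenvectorBasis, WithLp.toLp_smul, norm_smul]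
    using l2_opNorm_mulVec A (hA.eigenvectorBasis i)

lemma conj_mem_convexHull_unitaryGroup (U : unitaryGroup n 𝕜) {A : Matrix n n 𝕜}
    (hA : A ∈ convexHull ℝ (unitaryGroup n 𝕜 : Set (Matrix n n 𝕜))) :
    (U : Matrix n n 𝕜) * A * star (U : Matrix n n 𝕜) ∈
      convexHull ℝ (unitaryGroup n 𝕜 : Set (Matrix n n 𝕜)) := by
  let conj : Matrix n n 𝕜 →ₗ[ℝ] Matrix n n 𝕜 :=
    LinearMap.mulLeftRight ℝ ((U : Matrix n n 𝕜), star (U : Matrix n n 𝕜))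
  have hconj : conj '' unitaryGroup n 𝕜 ⊆ unitaryGroup n 𝕜 := by
    rintro _ ⟨V, hV, rfl⟩
    exact mul_mem (mul_mem U.2 hV) (Unitary.star_mem U.2)
  have himage := Set.mem_image_of_mem conj hA
  rw [conj.image_convexHull] at himage
  exact convexHull_mono hconj himage

lemma mem_convexHull_unitaryGroup_of_isHermitian {A : Matrix n n 𝕜} (hA : A.IsHermitian)
    (hnorm : ‖A‖ ≤ 1) : A ∈ convexHull ℝ (unitaryGroup n 𝕜 : Set (Matrix n n 𝕜)) := by
  rw [hA.spectral_theorem, Unitary.conjStarAlgAut_apply]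
  exact conj_mem_convexHull_unitaryGroup hA.eigenvectorUnitary
    (diagonal_ofReal_mem_convexHull_unitaryGroup fun i =>
      (abs_eigenvalues_le_norm hA i).trans hnorm)

lemma exists_mem_convexHull_unitaryGroup_mul_mul_conjTranspose_eq {S B : Matrix n n 𝕜}
    (hS : S.PosSemidef) (h : (B * Bᴴ - S).PosSemidef) :
    ∃ K ∈ convexHull ℝ (unitaryGroup n 𝕜 : Set (Matrix n n 𝕜)), (B * K) * (B * K)ᴴ = S := by
  obtain ⟨A, rfl⟩ := exists_mul_conjTranspose_eq hS
  obtain ⟨C, hC, rfl⟩ := exists_norm_le_one_mul_eq (le_iff.mpr h)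
  -- Only `C * Cᴴ` matters, so the contraction `C` may be replaced by a Hermitian one.
  set K := CFC.sqrt (C * Cᴴ)
  have hK : Kᴴ = K := (CFC.sqrt_nonneg (C * Cᴴ)).isSelfAdjoint
  have hKK : K * K = C * Cᴴ := CFC.sqrt_mul_sqrt_self _ (mul_star_self_nonneg C)
  have hK_norm : ‖K‖ ≤ 1 := by
    refine le_of_sq_le_sq ?_ zero_le_one
    calc ‖K‖ ^ 2 = ‖K * Kᴴ‖ := by rw [sq]; exact CStarRing.norm_self_mul_star.symm
      _ = ‖C‖ * ‖C‖ := by rw [hK, hKK]; exact CStarRing.norm_self_mul_star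
      _ ≤ 1 ^ 2 := by rw [← sq]; gcongr
  refine ⟨K, mem_convexHull_unitaryGroup_of_isHermitian hK hK_norm, ?_⟩
  calc (B * K) * (B * K)ᴴ = B * (K * K) * Bᴴ := by
        rw [conjTranspose_mul, hK]; simp only [Matrix.mul_assoc]
    _ = (B * C) * (B * C)ᴴ := by
        rw [hKK, conjTranspose_mul]; simp only [Matrix.mul_assoc]

end Contraction

section ConvexOrders

variable {Ω Ω' : Type*} [MeasurableSpace Ω] [MeasurableSpace Ω'] {n : ℕ} {P : Measure Ω}
  {Q : Measure Ω'} {X : Ω → EuclideanSpace ℝ (Fin n)} {Y : Ω' → EuclideanSpace ℝ (Fin n)}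

lemma convexOrder_of_mem_convexHull {α : Type*} [MeasurableSpace α] {ν : Measure α}
    {T : α → EuclideanSpace ℝ (Fin n)} (hX : IdentDistrib X T P ν)
    (hT : T ∈ convexHull ℝ {U | IdentDistrib U Y ν Q}) : ConvexOrder P Q X Y := by
  intro f hf hfX hfY
  have hf_meas : Measurable f :=
    (continuousOn_univ.mp (hf.continuousOn isOpen_univ)).measurable
  obtain ⟨ι, _, w, U, hw, hw_sum, hU, rfl⟩ := mem_convexHull_iff_exists_fintype.mp hT
  have hfU (i : ι) : IdentDistrib (f ∘ U i) (f ∘ Y) ν Q := (hU i).comp hf_meas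
  have hfU_int (i : ι) : Integrable (fun x => w i * f (U i x)) ν :=
    ((hfU i).integrable_iff.mpr hfY).const_mul (w i)
  have hfT : IdentDistrib (f ∘ X) (f ∘ ∑ i, w i • U i) P ν := hX.comp hf_meas
  calc ∫ ω, f (X ω) ∂P = ∫ x, f ((∑ i, w i • U i) x) ∂ν := hfT.integral_eq
    _ ≤ ∫ x, ∑ i, w i * f (U i x) ∂ν := by
        refine integral_mono (hfT.integrable_iff.mp hfX)
          (integrable_finsetSum _ fun i _ => hfU_int i) fun x => ?_
        simpa using hf.map_sum_le (fun i _ => hw i) hw_sum (p := fun i => U i x)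
          (fun _ _ => Set.mem_univ _)
    _ = ∑ i, w i * ∫ x, f (U i x) ∂ν := by
        rw [integral_finsetSum _ fun i _ => hfU_int i]
        simp only [integral_const_mul]
    _ = ∑ i, w i * ∫ ω, f (Y ω) ∂Q := by
        congr! 2 with i
        exact (hfU i).integral_eq
    _ = ∫ ω, f (Y ω) ∂Q := by rw [← Finset.sum_mul, hw_sum, one_mul]

lemma ConvexOrder.linearConvexOrder (h : ConvexOrder P Q X Y) : LinearConvexOrder P Q X Y :=
  fun a f hf => h (fun x => f ⟪a, x⟫) (hf.comp_linearMap (innerSL ℝ a).toLinearMap)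

lemma LinearConvexOrder.integral_eq (h : LinearConvexOrder P Q X Y) (hX : Integrable X P)
    (hY : Integrable Y Q) : ∫ ω, X ω ∂P = ∫ ω, Y ω ∂Q := by
  have hle (a : EuclideanSpace ℝ (Fin n)) : ⟪a, ∫ ω, X ω ∂P⟫ ≤ ⟪a, ∫ ω, Y ω ∂Q⟫ := by
    rw [← integral_inner hX, ← integral_inner hY]
    exact h a id (convexOn_id convex_univ) (hX.const_inner a) (hY.const_inner a)
  refine ext_inner_left ℝ fun a => (hle a).antisymm ?_
  simpa only [inner_neg_left, neg_le_neg_iff] using hle (-a)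

lemma LinearConvexOrder.integral_abs_inner_sub_le [IsFiniteMeasure P] [IsFiniteMeasure Q]
    (h : LinearConvexOrder P Q X Y) (hX : Integrable X P) (hY : Integrable Y Q)
    (a c : EuclideanSpace ℝ (Fin n)) :
    ∫ ω, |⟪a, X ω - c⟫| ∂P ≤ ∫ ω, |⟪a, Y ω - c⟫| ∂Q := by
  have hconvex : ConvexOn ℝ Set.univ fun x : ℝ => |x - ⟪a, c⟫| := by
    simpa only [Real.dist_eq] using convexOn_univ_dist ⟪a, c⟫
  simp only [inner_sub_right]
  exact h a _ hconvex ((hX.const_inner a).sub (integrable_const _)).abs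
    ((hY.const_inner a).sub (integrable_const _)).abs

end ConvexOrders

lemma charFun_map_const_add_clm {E F : Type*} [NormedAddCommGroup E] [InnerProductSpace ℝ E]
    [CompleteSpace E] [MeasurableSpace E] [BorelSpace E] [NormedAddCommGroup F]
    [InnerProductSpace ℝ F] [CompleteSpace F] [MeasurableSpace F] [BorelSpace F]
    (μ : Measure E) (m : F) (L : E →L[ℝ] F) (t : F) :
    charFun (μ.map fun x => m + L x) t =
      charFun μ (L.adjoint t) * Complex.exp (⟪m, t⟫ * Complex.I) := by
  have hinner (x : E) : ⟪m + L x, t⟫ = ⟪x, L.adjoint t⟫ + ⟪m, t⟫ := by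
    rw [inner_add_left, ContinuousLinearMap.adjoint_inner_right, add_comm]
  rw [charFun_apply, integral_map (by fun_prop) (by fun_prop), charFun_apply,
    ← integral_mul_const]
  simp only [hinner, Complex.ofReal_add, add_mul, Complex.exp_add]

namespace IsElliptical

variable {Ω Ω' : Type*} [MeasurableSpace Ω] [MeasurableSpace Ω'] {n : ℕ} {P : Measure Ω}
  {Q : Measure Ω'} {X : Ω → EuclideanSpace ℝ (Fin n)} {Y : Ω' → EuclideanSpace ℝ (Fin n)}
  {m m' : EuclideanSpace ℝ (Fin n)} {S S' : Matrix (Fin n) (Fin n) ℝ} {φ : ℝ → ℝ}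

lemma identDistrib [IsFiniteMeasure P] (hX : IsElliptical P X m S φ)
    {ν : Measure (EuclideanSpace ℝ (Fin n))} [IsFiniteMeasure ν]
    (hν : ∀ t, charFun ν t = φ (‖t‖ ^ 2)) {A : Matrix (Fin n) (Fin n) ℝ} (hA : A * Aᴴ = S) :
    IdentDistrib X (fun v => m + toEuclideanCLM (𝕜 := ℝ) A v) P ν := by
  refine ⟨hX.measurable.aemeasurable, by fun_prop, Measure.ext_of_charFun ?_⟩
  ext t
  have hadjoint : (toEuclideanCLM (𝕜 := ℝ) A).adjoint = toEuclideanCLM (𝕜 := ℝ) Aᴴ :=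
    (map_star (toEuclideanCLM (n := Fin n) (𝕜 := ℝ)) A).symm
  have hnorm : ‖toEuclideanCLM (𝕜 := ℝ) Aᴴ t‖ ^ 2 = t.ofLp ⬝ᵥ S *ᵥ t.ofLp := by
    rw [← hA]
    exact ofReal_norm_toEuclideanCLM_conjTranspose_sq A t
  rw [hX.charFun_eq, charFun_map_const_add_clm, hadjoint, hν, hnorm, real_inner_comm, mul_comm,
    mul_comm Complex.I]

lemma convexOrder [IsFiniteMeasure P] [IsFiniteMeasure Q] (hX : IsElliptical P X m S φ)
    (hY : IsElliptical Q Y m S' φ) (hS : (S' - S).PosSemidef) : ConvexOrder P Q X Y := by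
  obtain ⟨ν, _, hν⟩ := hX.generator
  obtain ⟨B, hB⟩ := exists_mul_conjTranspose_eq hY.posSemidef
  obtain ⟨K, hK, hBK⟩ := exists_mem_convexHull_unitaryGroup_mul_mul_conjTranspose_eq
    hX.posSemidef (by rwa [hB])
  let transform : Matrix (Fin n) (Fin n) ℝ →ᵃ[ℝ]
      (EuclideanSpace ℝ (Fin n) → EuclideanSpace ℝ (Fin n)) :=
    AffineMap.const ℝ _ (fun _ => m) + LinearMap.toAffineMap
      { toFun := fun K v => toEuclideanCLM (𝕜 := ℝ) (B * K) v
        map_add' := fun K L => by ext1 v; simp [mul_add]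
        map_smul' := fun r K => by ext1 v; simp }
  have hunitary : transform '' unitaryGroup (Fin n) ℝ ⊆ {U | IdentDistrib U Y ν Q} := by
    rintro _ ⟨U, hU, rfl⟩
    refine (hY.identDistrib hν ?_).symm
    rw [conjTranspose_mul, Matrix.mul_assoc, ← Matrix.mul_assoc U, ← star_eq_conjTranspose U,
      mem_unitaryGroup_iff.mp hU, Matrix.one_mul, hB]
  have hmem := Set.mem_image_of_mem transform hK
  rw [transform.image_convexHull] at hmem
  exact convexOrder_of_mem_convexHull (hX.identDistrib hν hBK) (convexHull_mono hunitary hmem)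

lemma charFun_map_inner_sub (hX : IsElliptical P X m S φ) (a : EuclideanSpace ℝ (Fin n)) (s : ℝ) :
    charFun (P.map fun ω => ⟪a, X ω - m⟫) s = φ (s ^ 2 * (a.ofLp ⬝ᵥ S *ᵥ a.ofLp)) := by
  have hmap : P.map (fun ω => ⟪a, X ω - m⟫) =
      (P.map X).map fun x => -⟪a, m⟫ + innerSL ℝ a x := by
    rw [Measure.map_map (by fun_prop) hX.measurable]
    congr! with ω
    simp only [Function.comp_apply, innerSL_apply_apply, inner_sub_right, neg_add_eq_sub]
  have hadjoint : (innerSL ℝ a).adjoint s = s • a := by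
    refine ext_inner_right ℝ fun v => ?_
    simp [ContinuousLinearMap.adjoint_inner_left, inner_smul_left, mul_comm]
  have hphase : Complex.I * ⟪s • a, m⟫ + ⟪-⟪a, m⟫, s⟫ * Complex.I = 0 := by
    simp only [inner_smul_left, Real.ringHom_apply, Complex.ofReal_mul, RCLike.inner_apply, mul_neg,
      Complex.ofReal_neg, neg_mul]
    ring
  have hquad : (s • a).ofLp ⬝ᵥ S *ᵥ (s • a).ofLp = s ^ 2 * (a.ofLp ⬝ᵥ S *ᵥ a.ofLp) := by
    simp only [WithLp.ofLp_smul, mulVec_smul, dotProduct_smul, smul_dotProduct, smul_eq_mul]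
    ring
  rw [hmap, charFun_map_const_add_clm, hadjoint, hX.charFun_eq, mul_right_comm, ← Complex.exp_add,
    hphase, Complex.exp_zero, one_mul, hquad]

lemma identDistrib_inner_sub [IsFiniteMeasure P] [IsFiniteMeasure Q]
    (hX : IsElliptical P X m S φ) (hY : IsElliptical Q Y m' S' φ)
    {a b : EuclideanSpace ℝ (Fin n)} {c : ℝ}
    (h : a.ofLp ⬝ᵥ S *ᵥ a.ofLp = c ^ 2 * (b.ofLp ⬝ᵥ S' *ᵥ b.ofLp)) :
    IdentDistrib (fun ω => ⟪a, X ω - m⟫) (fun ω => c * ⟪b, Y ω - m'⟫) P Q := by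
  have hXm : Measurable fun ω => ⟪a, X ω - m⟫ := by have := hX.measurable; fun_prop
  have hYm : Measurable fun ω => ⟪b, Y ω - m'⟫ := by have := hY.measurable; fun_prop
  refine ⟨hXm.aemeasurable, (hYm.const_mul c).aemeasurable, Measure.ext_of_charFun ?_⟩
  ext s
  rw [charFun_map_mul_comp hYm.aemeasurable, hX.charFun_map_inner_sub, hY.charFun_map_inner_sub, h,
    mul_pow, mul_left_comm, mul_assoc]

lemma integral_eq [IsProbabilityMeasure P] (hX : IsElliptical P X m S φ) (hint : Integrable X P) :
    ∫ ω, X ω ∂P = m := by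
  refine ext_inner_left ℝ fun a => ?_
  have hsymm : ∫ ω, ⟪a, X ω - m⟫ ∂P = ∫ ω, -1 * ⟪a, X ω - m⟫ ∂P :=
    (hX.identDistrib_inner_sub hX (by ring)).integral_eq
  have hcenter : ∫ ω, ⟪a, X ω - m⟫ ∂P = ⟪a, ∫ ω, X ω ∂P⟫ - ⟪a, m⟫ := by
    simp only [inner_sub_right]
    rw [integral_sub (hint.const_inner a) (integrable_const _), integral_inner hint,
      integral_const, probReal_univ, one_smul]
  rw [integral_const_mul, hcenter] at hsymm
  linarith

lemma generator_eq_one_of_ae_eq_zero [IsProbabilityMeasure P] (hX : IsElliptical P X m S φ)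
    {a : EuclideanSpace ℝ (Fin n)} (ha : 0 < a.ofLp ⬝ᵥ S *ᵥ a.ofLp)
    (h : ∀ᵐ ω ∂P, ⟪a, X ω - m⟫ = 0) {u : ℝ} (hu : 0 ≤ u) : φ u = 1 := by
  set q := a.ofLp ⬝ᵥ S *ᵥ a.ofLp
  have hcharFun := hX.charFun_map_inner_sub a √(u / q)
  rw [Real.sq_sqrt (by positivity), div_mul_cancel₀ _ ha.ne', Measure.map_congr h,
    Measure.map_const, measure_univ, one_smul, charFun_dirac] at hcharFun
  exact_mod_cast (by simpa using hcharFun.symm : (φ u : ℂ) = 1)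

lemma dotProduct_mulVec_le_of_integral_abs_le [IsProbabilityMeasure P] [IsFiniteMeasure Q]
    (hX : IsElliptical P X m S φ) (hY : IsElliptical Q Y m' S' φ) (hφ : ∃ u, 0 ≤ u ∧ φ u ≠ 1)
    (hint : Integrable X P) {a b : EuclideanSpace ℝ (Fin n)}
    (h : ∫ ω, |⟪a, X ω - m⟫| ∂P ≤ ∫ ω, |⟪b, Y ω - m'⟫| ∂Q) :
    a.ofLp ⬝ᵥ S *ᵥ a.ofLp ≤ b.ofLp ⬝ᵥ S' *ᵥ b.ofLp := by
  by_contra! hlt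
  have hnonneg : 0 ≤ b.ofLp ⬝ᵥ S' *ᵥ b.ofLp := hY.posSemidef.dotProduct_mulVec_nonneg b.ofLp
  have hpos := hnonneg.trans_lt hlt
  set c := √((b.ofLp ⬝ᵥ S' *ᵥ b.ofLp) / (a.ofLp ⬝ᵥ S *ᵥ a.ofLp))
  have hc : c < 1 := by rwa [Real.sqrt_lt' one_pos, one_pow, div_lt_one hpos]
  have hscale : ∫ ω, |⟪b, Y ω - m'⟫| ∂Q = c * ∫ ω, |⟪a, X ω - m⟫| ∂P := by
    have hident : IdentDistrib (fun ω => ⟪b, Y ω - m'⟫) (fun ω => c * ⟪a, X ω - m⟫) Q P :=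
      hY.identDistrib_inner_sub hX
        (by rw [Real.sq_sqrt (by positivity), div_mul_cancel₀ _ hpos.ne'])
    have habs := (hident.comp measurable_norm).integral_eq
    simpa [abs_mul, integral_const_mul, abs_of_nonneg (show 0 ≤ c from Real.sqrt_nonneg _)]
      using habs
  have hzero : ∫ ω, |⟪a, X ω - m⟫| ∂P = 0 := by
    have : 0 ≤ ∫ ω, |⟪a, X ω - m⟫| ∂P := by positivity
    nlinarith
  have hint_abs : Integrable (fun ω => |⟪a, X ω - m⟫|) P :=
    ((hint.sub (integrable_const m)).const_inner a).abs
  rw [integral_eq_zero_iff_of_nonneg (fun _ => abs_nonneg _) hint_abs] at hzero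
  obtain ⟨u, hu, hu_ne⟩ := hφ
  refine hu_ne (hX.generator_eq_one_of_ae_eq_zero hpos ?_ hu)
  filter_upwards [hzero] with ω hω using abs_eq_zero.mp hω

lemma posSemidef_sub [IsProbabilityMeasure P] [IsFiniteMeasure Q] (hX : IsElliptical P X m S φ)
    (hY : IsElliptical Q Y m S' φ) (hφ : ∃ u, 0 ≤ u ∧ φ u ≠ 1) (hXint : Integrable X P)
    (hYint : Integrable Y Q) (h : LinearConvexOrder P Q X Y) : (S' - S).PosSemidef := by
  refine .of_dotProduct_mulVec_nonneg
    (hY.posSemidef.isHermitian.sub hX.posSemidef.isHermitian) fun a => ?_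
  rw [star_trivial, sub_mulVec, dotProduct_sub, sub_nonneg]
  exact hX.dotProduct_mulVec_le_of_integral_abs_le hY hφ hXint
    (h.integral_abs_inner_sub_le hXint hYint (WithLp.toLp 2 a) m)

end IsElliptical

theorem theorem3p2 {Ω Ω' : Type*} [MeasurableSpace Ω] [MeasurableSpace Ω'] {n : ℕ}
    (P : Measure Ω) (Q : Measure Ω') [IsProbabilityMeasure P] [IsProbabilityMeasure Q]
    (X : Ω → EuclideanSpace ℝ (Fin n)) (Y : Ω' → EuclideanSpace ℝ (Fin n))
    (μx μy : EuclideanSpace ℝ (Fin n)) (Sx Sy : Matrix (Fin n) (Fin n) ℝ) (φ : ℝ → ℝ)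
    (hX : IsElliptical P X μx Sx φ) (hY : IsElliptical Q Y μy Sy φ)
    (hφ : ∃ u : ℝ, 0 ≤ u ∧ φ u ≠ 1)
    (hXint : Integrable X P) (hYint : Integrable Y Q) :
    List.TFAE [
      μy = μx ∧ (Sy - Sx).PosSemidef,
      ConvexOrder P Q X Y,
      LinearConvexOrder P Q X Y] := by
  tfae_have 1 → 2 := by
    rintro ⟨rfl, hS⟩
    exact hX.convexOrder hY hS
  tfae_have 2 → 3 := ConvexOrder.linearConvexOrder
  tfae_have 3 → 1 := by
    intro h
    obtain rfl : μx = μy := by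
      rw [← hX.integral_eq hXint, ← hY.integral_eq hYint, h.integral_eq hXint hYint]
    exact ⟨rfl, hX.posSemidef_sub hY hφ hXint hYint h⟩
  tfae_finish
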